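/- Let $(\Omega,\mathcal F,\mathbb P)$ be a probability space, $\Omega$ Polish and $\mathcal F$ containing the Borel sets, with a measurable, measure-preserving, ergodic action $(\tau_x)_{x\in\mathbb R}$. Let $a,V:\mathbb R\times\Omega\to[0,1]$ be measurable stationary processes (i.e. $a(x+y,\omega)=a(x,\tau_y\omega)$, and likewise for $V$) such that, for some $\kappa>0$, $\sqrt{a(\cdot,\omega)}$ and $V(\cdot,\omega)$ are $\kappa$-Lipschitz for every $\omega$, and $\operatorname{ess\,inf}_x V(x,\omega)=0$, $\operatorname{ess\,sup}_x V(x,\omega)=1$ almost surely. Let $\beta>0$, and let $G:\mathbb R\to[0,+\infty)$ be convex with $G(0)=0$ and, for some constants $\alpha_0,\alpha_1>0$, $\gamma>1$ and all $p,q\in\mathbb R$, $$\alpha_0|p|^\gamma-\tfrac1{\alpha_0}\le G(p)\le\alpha_1(|p|^\gamma+1),\qquad |G(p)-G(q)|\le\alpha_1(|p|+|q|+1)^{\gamma-1}|p-q|.$$ For $\theta\in\mathbb R$ let $\mathcal H_\beta(G)(\theta)$ be the effective Hamiltonian, i.e. the almost surely constant limit of $u_\theta(t,0,\omega)/t$ as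 $t\to+\infty$, where $u_\theta$ is the Lipschitz viscosity solution of $\partial_t u=a(x,\omega)\partial^2_{xx}u+G(\partial_xu)+\beta V(x,\omega)$ in $(0,+\infty)\times\mathbb R$ with $u_\theta(0,x)=\theta x$. Assume $\lambda:=\mathcal H_\beta(G)(\theta)>\beta$, and let $F_\theta$ be a corrector: a $C(\mathbb R)$-valued random variable for which there is a set $\Omega_\theta$ of probability $1$, with $\tau_z(\Omega_\theta)=\Omega_\theta$ for all $z$, such that for every $\omega\in\Omega_\theta$ one has $F_\theta(0,\omega)=0$ and $F_\theta(\cdot,\omega)$ is a Lipschitz viscosity solution of $$a(x,\omega)u''+G(\theta+u')+\beta V(x,\omega)=\lambda\quad\text{in }\mathbb R$$ with sublinear growth, $F_\theta(x,\omega)/(1+|x|)\to0$ as $|x|\to\infty$. Then: (i) If $\theta>0$, there are $b^-_\lambda>a^-_\lambda>0$ with $G(a^-_\lambda)=\lambda-\beta$ and $G(b^-_\lambda)=\lambda$, and for any positive $a^-_\lambda,b^-_\lambda$ solving these two equations and every $\omega\in\Omega_\theta$, $$a^-_\lambda(x-y)\ge\theta(x-y)+F_\theta(x,\omega)-F_\theta(y,\omega)\ge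 b^-_\lambda(x-y)\quad\text{for all }x<y,$$ $$a^-_\lambda\le\theta+F_\theta'(y,\omega)\le b^-_\lambda\quad\text{for a.e. }y\in\mathbb R.$$ (ii) If $\theta<0$, there are $b^+_\lambda>a^+_\lambda>0$ with $G(-a^+_\lambda)=\lambda-\beta$ and $G(-b^+_\lambda)=\lambda$, and for any positive $a^+_\lambda,b^+_\lambda$ solving these two equations and every $\omega\in\Omega_\theta$, $$-a^+_\lambda(x-y)\ge\theta(x-y)+F_\theta(x,\omega)-F_\theta(y,\omega)\ge-b^+_\lambda(x-y)\quad\text{for all }x>y,$$ $$-b^+_\lambda\le\theta+F_\theta'(y,\omega)\le-a^+_\lambda\quad\text{for a.e. }y\in\mathbb R.$$ -/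

import Mathlib

open MeasureTheory Filter Topology Set

namespace ViscousHJ

/-- A measurable, measure preserving and ergodic action `(τ_x)` of `ℝ` on a probability space. -/
structure IsErgodicFlow {Ω : Type*} [MeasurableSpace Ω] (P : Measure Ω) (τ : ℝ → Ω → Ω) :
    Prop where
  measurable : Measurable fun p : ℝ × Ω => τ p.1 p.2
  zero : ∀ ω, τ 0 ω = ω
  add : ∀ x y ω, τ (x + y) ω = τ x (τ y ω)
  measure_image : ∀ x, ∀ E : Set Ω, MeasurableSet E → P (τ x '' E) = P E
  ergodic : ∀ f : Ω → ℝ, Measurable f → (∀ x, ∀ᵐ ω ∂P, f (τ x ω) = f ω) →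
    ∃ c : ℝ, ∀ᵐ ω ∂P, f ω = c

/-- A random process `f(x, ω)` that is jointly measurable, stationary with respect to the shifts
`τ` and takes values in `[0,1]`. -/
structure IsStationaryProcess {Ω : Type*} [MeasurableSpace Ω] (τ : ℝ → Ω → Ω)
    (f : ℝ → Ω → ℝ) : Prop where
  measurable : Measurable fun p : ℝ × Ω => f p.1 p.2
  stationary : ∀ x y ω, f (x + y) ω = f x (τ y ω)
  mem_Icc : ∀ x ω, f x ω ∈ Icc (0 : ℝ) 1

/-- The standing assumptions on the diffusion coefficient `a` and the potential `V`: stationary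
processes with values in `[0,1]`, with `√a` and `V` being `κ`-Lipschitz in `x` for every `ω`
(so both are continuous in `x`), and with essential infimum `0` and essential supremum `1` of
`V(·, ω)` almost surely. -/
structure IsMedium {Ω : Type*} [MeasurableSpace Ω] (P : Measure Ω) (τ : ℝ → Ω → Ω)
    (κ : ℝ) (a V : ℝ → Ω → ℝ) : Prop where
  process_a : IsStationaryProcess τ a
  process_V : IsStationaryProcess τ V
  lipschitz_sqrt_a : ∀ ω x y, |Real.sqrt (a x ω) - Real.sqrt (a y ω)| ≤ κ * |x - y|
  lipschitz_V : ∀ ω x y, |V x ω - V y ω| ≤ κ * |x - y|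
  ess_V : ∀ᵐ ω ∂P, essInf (fun x => V x ω) volume = 0 ∧ essSup (fun x => V x ω) volume = 1

/-- The class `ℋ(γ, α₀, α₁)` of continuous functions with the two growth conditions. -/
structure IsHamiltonian (γ α₀ α₁ : ℝ) (G : ℝ → ℝ) : Prop where
  continuous : Continuous G
  lower : ∀ p, α₀ * |p| ^ γ - 1 / α₀ ≤ G p
  upper : ∀ p, G p ≤ α₁ * (|p| ^ γ + 1)
  increment : ∀ p q, |G p - G q| ≤ α₁ * (|p| + |q| + 1) ^ (γ - 1) * |p - q|

/-- `u` is a viscosity subsolution of `∂ₜu = a(x) ∂ₓₓu + G(∂ₓu) + β V(x)` in `(0,∞) × ℝ`. -/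
def IsParabolicSubsolution (a V : ℝ → ℝ) (G : ℝ → ℝ) (β : ℝ) (u : ℝ → ℝ → ℝ) : Prop :=
  ∀ φ : ℝ × ℝ → ℝ, ContDiff ℝ 2 φ → ∀ t x : ℝ, 0 < t →
    IsLocalMax (fun p : ℝ × ℝ => u p.1 p.2 - φ p) (t, x) →
    deriv (fun s => φ (s, x)) t ≤
      a x * deriv (deriv fun z => φ (t, z)) x + G (deriv (fun z => φ (t, z)) x) + β * V x

/-- `u` is a viscosity supersolution of `∂ₜu = a(x) ∂ₓₓu + G(∂ₓu) + β V(x)` in `(0,∞) × ℝ`. -/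
def IsParabolicSupersolution (a V : ℝ → ℝ) (G : ℝ → ℝ) (β : ℝ) (u : ℝ → ℝ → ℝ) : Prop :=
  ∀ φ : ℝ × ℝ → ℝ, ContDiff ℝ 2 φ → ∀ t x : ℝ, 0 < t →
    IsLocalMin (fun p : ℝ × ℝ => u p.1 p.2 - φ p) (t, x) →
    a x * deriv (deriv fun z => φ (t, z)) x + G (deriv (fun z => φ (t, z)) x) + β * V x ≤
      deriv (fun s => φ (s, x)) t

/-- `u` is a Lipschitz continuous viscosity solution on `[0,∞) × ℝ` of the parabolic equation
`∂ₜu = a(x) ∂ₓₓu + G(∂ₓu) + β V(x)` with initial datum `u(0, x) = θ x`. -/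
structure IsLinearDataSolution (a V : ℝ → ℝ) (G : ℝ → ℝ) (β θ : ℝ) (u : ℝ → ℝ → ℝ) :
    Prop where
  lipschitz : ∃ K, LipschitzOnWith K (fun p : ℝ × ℝ => u p.1 p.2) (Ici (0 : ℝ) ×ˢ univ)
  initial : ∀ x, u 0 x = θ * x
  subsolution : IsParabolicSubsolution a V G β u
  supersolution : IsParabolicSupersolution a V G β u

/-- The solution `u_θ` (unique on `[0,∞) × ℝ`) of the parabolic equation with datum `θ x`. -/
noncomputable def linearDataSolution (a V : ℝ → ℝ) (G : ℝ → ℝ) (β θ : ℝ) : ℝ → ℝ → ℝ :=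
  Classical.epsilon fun u : ℝ → ℝ → ℝ => IsLinearDataSolution a V G β θ u

/-- The effective Hamiltonian `ℋ_β(G)(θ)`: the deterministic number which is almost surely the
limit of `u_θ(t, 0, ω) / t` as `t → +∞`. -/
noncomputable def effectiveHamiltonian {Ω : Type*} [MeasurableSpace Ω] (P : Measure Ω)
    (a V : ℝ → Ω → ℝ) (G : ℝ → ℝ) (β θ : ℝ) : ℝ :=
  Classical.epsilon fun c : ℝ => ∀ᵐ ω ∂P,
    Tendsto (fun t : ℝ => linearDataSolution (fun x => a x ω) (fun x => V x ω) G β θ t 0 / t)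
      atTop (𝓝 c)

/-- `u` is a viscosity solution of `a(x) u'' + G(θ + u') + β V(x) = lam` in `ℝ`. The sign
convention for sub- and supersolutions is that of the parabolic equation above, that is, of the
degenerate elliptic form `-a(x) u'' - G(θ + u') - β V(x) + lam = 0`. -/
structure IsStationarySolution (a V : ℝ → ℝ) (G : ℝ → ℝ) (β θ lam : ℝ) (u : ℝ → ℝ) :
    Prop where
  continuous : Continuous u
  subsolution : ∀ φ : ℝ → ℝ, ContDiff ℝ 2 φ → ∀ x : ℝ, IsLocalMax (fun z => u z - φ z) x →
    lam ≤ a x * deriv (deriv φ) x + G (θ + deriv φ x) + β * V x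
  supersolution : ∀ φ : ℝ → ℝ, ContDiff ℝ 2 φ → ∀ x : ℝ, IsLocalMin (fun z => u z - φ z) x →
    a x * deriv (deriv φ) x + G (θ + deriv φ x) + β * V x ≤ lam

/-- Sublinear growth: `u(x) / (1 + |x|) → 0` as `|x| → ∞`. -/
def IsSublinear (u : ℝ → ℝ) : Prop :=
  Tendsto (fun x => u x / (1 + |x|)) (cocompact ℝ) (𝓝 0)

/-- The random variable `F` with values in `C(ℝ)` (with the Borel sets of locally uniform
convergence) is a corrector for `a(x, ω) u'' + G(θ + u') + β V(x, ω) = lam`, and `S` is the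
accompanying shift-invariant set of probability one. -/
structure IsCorrector {Ω : Type*} [MeasurableSpace Ω] (P : Measure Ω) (τ : ℝ → Ω → Ω)
    (a V : ℝ → Ω → ℝ) (G : ℝ → ℝ) (β θ lam : ℝ) (F : Ω → C(ℝ, ℝ)) (S : Set Ω) : Prop where
  measurable : Measurable[_, borel C(ℝ, ℝ)] F
  full : ∀ᵐ ω ∂P, ω ∈ S
  invariant : ∀ z, τ z '' S = S
  zero : ∀ ω ∈ S, F ω 0 = 0
  lipschitz : ∀ ω ∈ S, ∃ K, LipschitzWith K (F ω)
  sublinear : ∀ ω ∈ S, IsSublinear (F ω)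
  solution : ∀ ω ∈ S, IsStationarySolution (fun x => a x ω) (fun x => V x ω) G β θ lam (F ω)

end ViscousHJ

namespace ViscousHJ

/-! The argument is pathwise and rests on barriers on a left half-line. Let `θ > 0` and `w = θ x +
F`. By convexity, `G 0 = 0` and `0 ≤ G`, one has `G > lam` beyond `B` and `G < lam - β` on `[0, A)`.
If `w` rises too steeply between `x` and `y`, a slightly concave parabola touches it from below at
some point left of `y`, with slope above `B`; there `G` violates the supersolution inequality
(`slope_le_of_supersolution`). If `w` rises too slowly, a slightly curved exponential touches it
from above, with slope in `(0, A)`; even with `V = 1` the subsolution inequality fails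
(`le_slope_of_subsolution`). The diffusion term is negligible because `a ≤ 1` and the curvature is
arbitrarily small. The case `θ < 0` follows by reflection. -/

/-- Supplies the touching points: decay at `-∞` and the larger value at `x` keep a maximum over a
long interval away from both endpoints. -/
lemma exists_isLocalMax_lt_of_tendsto_atBot {f : ℝ → ℝ} (hf : Continuous f)
    (hbot : Tendsto f atBot atBot) {x y : ℝ} (hxy : x < y) (h : f y < f x) :
    ∃ z < y, IsLocalMax f z := by
  obtain ⟨R, hR⟩ := eventually_atBot.1 (hbot.eventually (eventually_lt_atBot (f x)))
  obtain ⟨z, hz, hmax⟩ := (isCompact_Icc (a := min R x) (b := y)).exists_isMaxOn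
    ⟨x, min_le_right _ _, hxy.le⟩ hf.continuousOn
  have hxz : f x ≤ f z := hmax ⟨min_le_right _ _, hxy.le⟩
  have hzy : z < y := lt_of_le_of_ne hz.2 (by rintro rfl; linarith)
  have hRz : min R x < z := lt_of_le_of_ne hz.1 (by
    intro h'
    have := hR _ (min_le_left R x)
    rw [h'] at this
    linarith)
  exact ⟨z, hzy, hmax.isLocalMax (Icc_mem_nhds hRz hzy)⟩

/-! ### Monotonicity and levels of the Hamiltonian -/

/-- A convex function vanishing at `0` lies below its chords from the origin. -/
lemma le_chord_of_convexOn {G : ℝ → ℝ} (hG : ConvexOn ℝ univ G) (h0 : G 0 = 0) {p q : ℝ}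
    (hp : 0 ≤ p) (hpq : p ≤ q) (hq : 0 < q) : G p ≤ p / q * G q := by
  have h : G ((1 - p / q) • 0 + (p / q) • q) ≤ (1 - p / q) • G 0 + (p / q) • G q :=
    hG.2 (mem_univ 0) (mem_univ q) (by rw [sub_nonneg, div_le_one hq]; exact hpq)
      (by positivity) (by ring)
  simpa only [smul_eq_mul, mul_zero, zero_add, h0, div_mul_cancel₀ _ hq.ne'] using h

/-- A convex function vanishing at `0` is, on `[0, q]`, strictly below a positive value at `q`. -/
lemma lt_of_convexOn_of_pos {G : ℝ → ℝ} (hG : ConvexOn ℝ univ G) (h0 : G 0 = 0) {p q : ℝ}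
    (hp : 0 ≤ p) (hpq : p < q) (hq : 0 < G q) : G p < G q := by
  have hq0 : 0 < q := hp.trans_lt hpq
  exact (le_chord_of_convexOn hG h0 hp hpq.le hq0).trans_lt
    (mul_lt_of_lt_one_left hq ((div_lt_one hq0).2 hpq))

/-- A nonnegative convex function vanishing at `0` is nondecreasing on the positive half-line. -/
lemma le_of_convexOn_of_nonneg {G : ℝ → ℝ} (hG : ConvexOn ℝ univ G) (h0 : G 0 = 0)
    (hnn : ∀ p, 0 ≤ G p) {p q : ℝ} (hp : 0 ≤ p) (hpq : p ≤ q) : G p ≤ G q := by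
  rcases hpq.eq_or_lt with rfl | hlt
  · exact le_rfl
  have hq0 : 0 < q := hp.trans_lt hlt
  exact (le_chord_of_convexOn hG h0 hp hpq hq0).trans
    (mul_le_of_le_one_left (hnn q) ((div_le_one hq0).2 hpq))

/-- Beyond a positive point where it is positive, a convex function vanishing at `0` is strictly
increasing. -/
lemma lt_of_convexOn_of_pos_left {G : ℝ → ℝ} (hG : ConvexOn ℝ univ G) (h0 : G 0 = 0)
    (hnn : ∀ p, 0 ≤ G p) {p q : ℝ} (hp : 0 < p) (hpq : p < q) (hGp : 0 < G p) : G p < G q :=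
  lt_of_convexOn_of_pos hG h0 hp.le hpq
    (hGp.trans_le (le_of_convexOn_of_nonneg hG h0 hnn hp.le hpq.le))

lemma exists_pos_eq_of_coercive {G : ℝ → ℝ} (hc : Continuous G) (h0 : G 0 = 0)
    {γ α : ℝ} (hγ : 0 < γ) (hα : 0 < α) (hlow : ∀ p, α * |p| ^ γ - 1 / α ≤ G p)
    {c : ℝ} (hcpos : 0 < c) : ∃ p, 0 < p ∧ G p = c := by
  have ht : Tendsto (fun p : ℝ => α * p ^ γ - 1 / α) atTop atTop :=
    tendsto_atTop_add_const_right _ _ ((tendsto_rpow_atTop hγ).const_mul_atTop hα)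
  obtain ⟨M, hM, hM0⟩ := ((ht.eventually_ge_atTop c).and (eventually_ge_atTop 0)).exists
  have hGM : c ≤ G M := by
    have := hlow M
    rw [abs_of_nonneg hM0] at this
    exact hM.trans this
  obtain ⟨p, hp, hpc⟩ := intermediate_value_Icc hM0 hc.continuousOn
    (show c ∈ Icc (G 0) (G M) from ⟨by rw [h0]; exact hcpos.le, hGM⟩)
  refine ⟨p, lt_of_le_of_ne hp.1 ?_, hpc⟩
  rintro rfl
  rw [h0] at hpc
  exact hcpos.ne hpc

/-- Sublinearity lets `F` cancel at most half of the linear term near `-∞`. -/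
lemma tendsto_linear_add_sublinear_atBot {F : ℝ → ℝ} (hF : IsSublinear F) {θ : ℝ}
    (hθ : 0 < θ) : Tendsto (fun z => θ * z + F z) atBot atBot := by
  have h1 : Tendsto (fun x => F x / (1 + |x|)) atBot (𝓝 0) :=
    hF.mono_left (by rw [cocompact_eq_atBot_atTop]; exact le_sup_left)
  have h2 : Tendsto (fun z : ℝ => θ / 2 * z + θ / 2) atBot atBot :=
    tendsto_atBot_add_const_right _ _ (tendsto_id.const_mul_atBot (by positivity))
  refine tendsto_atBot_mono' _ ?_ h2
  filter_upwards [h1.eventually (gt_mem_nhds (half_pos hθ)), eventually_le_atBot 0] with z hz hz0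
  rw [div_lt_iff₀ (by positivity), abs_of_nonpos hz0] at hz
  linarith

/-! ### Barriers for the two slope bounds -/

/-- Upper slope bound for Lipschitz supersolutions: they cannot be steeper than a level `B` beyond
which `G` exceeds `lam`. -/
lemma slope_le_of_supersolution {a V G F : ℝ → ℝ} {β θ lam B : ℝ}
    (ha : ∀ x, a x ∈ Icc (0 : ℝ) 1) (hV : ∀ x, V x ∈ Icc (0 : ℝ) 1) (hβ : 0 ≤ β)
    (hF : IsStationarySolution a V G β θ lam F) (hlip : ∃ K, LipschitzWith K F)
    (hG : ∀ p, B < p → lam < G p) (hmono : ∀ p q, B < p → p ≤ q → G p ≤ G q)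
    {x y : ℝ} (hxy : x < y) : θ * (y - x) + F y - F x ≤ B * (y - x) := by
  by_contra! hcon
  set d := y - x with hd
  have hd0 : 0 < d := sub_pos.2 hxy
  obtain ⟨p, hBp, hp⟩ : ∃ p, B < p ∧ p * d < θ * d + F y - F x := by
    obtain ⟨p, h1, h2⟩ := exists_between ((lt_div_iff₀ hd0).2 hcon)
    exact ⟨p, h1, (lt_div_iff₀ hd0).1 h2⟩
  -- The first bound on `ε` makes `G p` beat the diffusion term; the second absorbs the drop `ε / 2
  -- * d ^ 2` of the parabola at `x`.
  obtain ⟨ε, hε, hεG, hεd⟩ : ∃ ε > 0, ε < G p - lam ∧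
      p * d + ε / 2 * d ^ 2 < θ * d + F y - F x := by
    have hgap : 0 < (θ * d + F y - F x - p * d) / d ^ 2 := div_pos (by linarith) (by positivity)
    obtain ⟨ε, h1, h2⟩ := exists_between (lt_min (sub_pos.2 (hG p hBp)) hgap)
    refine ⟨ε, h1, h2.trans_le (min_le_left _ _), ?_⟩
    have := (lt_div_iff₀ (by positivity)).1 (h2.trans_le (min_le_right _ _))
    nlinarith [mul_pos h1 (pow_pos hd0 2)]
  -- Concavity makes `θ + φ'` at least `p` everywhere left of `y`, so the location of the touching
  -- point is irrelevant.
  let φ : ℝ → ℝ := fun z => -(ε / 2) * (z - y) ^ 2 + p * (z - y) - θ * z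
  have hφ : ContDiff ℝ 2 φ := by fun_prop
  have hφ1 : ∀ z, HasDerivAt φ (-ε * (z - y) + p - θ) z := fun z => by
    have h := (((((hasDerivAt_id' z).sub_const y).pow 2).const_mul (-(ε / 2))).add
      (((hasDerivAt_id' z).sub_const y).const_mul p)).sub ((hasDerivAt_id' z).const_mul θ)
    refine h.congr_deriv ?_
    push_cast
    ring
  have hφ1' : deriv φ = fun z => -ε * (z - y) + p - θ := funext fun z => (hφ1 z).deriv
  have hφ2 : ∀ z, deriv (deriv φ) z = -ε := fun z => by
    rw [hφ1']
    have h := (((((hasDerivAt_id' z).sub_const y).const_mul (-ε)).add_const p).sub_const θ)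
    rw [h.deriv, mul_one]
  obtain ⟨K, hK⟩ := hlip
  have hbot : Tendsto (fun z => φ z - F z) atBot atBot := by
    -- The Lipschitz bound `F z ≥ F 0 + K z` for `z ≤ 0` bounds `φ - F` by `z` times this affine
    -- function, plus a constant.
    have hlin : Tendsto (fun z : ℝ => -(ε / 2) * z + (ε * y + p - θ - K)) atBot atTop :=
      tendsto_atTop_add_const_right _ _
        (tendsto_id.const_mul_atBot_of_neg (by linarith))
    have hquad := tendsto_atBot_add_const_right atBot (-(ε / 2) * y ^ 2 - p * y - F 0)
      (tendsto_id.atBot_mul_atTop₀ hlin)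
    refine tendsto_atBot_mono' _ ?_ hquad
    filter_upwards [eventually_le_atBot 0] with z hz
    have h := hK.dist_le_mul z 0
    rw [Real.dist_eq, Real.dist_eq, sub_zero, abs_of_nonpos hz] at h
    have h' := (abs_le.1 h).1
    simp only [φ, id]
    nlinarith
  obtain ⟨z, hzy, hz⟩ := exists_isLocalMax_lt_of_tendsto_atBot
    (hφ.continuous.sub hF.continuous) hbot hxy (by
      simp only [φ, Pi.sub_apply]
      have : x = y - d := by rw [hd]; ring
      rw [this] at hεd ⊢
      nlinarith)
  have hmin : IsLocalMin (fun z => F z - φ z) z := by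
    simpa [Pi.sub_apply] using hz.neg
  have h := hF.supersolution φ hφ z hmin
  rw [hφ2, (hφ1 z).deriv] at h
  have hGz : G p ≤ G (θ + (-ε * (z - y) + p - θ)) := hmono _ _ hBp (by nlinarith)
  nlinarith [(ha z).2, mul_nonneg hβ (hV z).1]

/-- Lower slope bound for subsolutions with positive mean slope at `-∞`: they cannot be flatter than
a level `A` below which `G` is smaller than `lam - β`. -/
lemma le_slope_of_subsolution {a V G F : ℝ → ℝ} {β θ lam A : ℝ}
    (ha : ∀ x, a x ∈ Icc (0 : ℝ) 1) (hV : ∀ x, V x ∈ Icc (0 : ℝ) 1) (hβ : 0 ≤ β)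
    (hF : IsStationarySolution a V G β θ lam F) (hsub : IsSublinear F) (hθ : 0 < θ) (hA : 0 < A)
    (hG : ∀ p, 0 ≤ p → p < A → G p < lam - β) (hmono : ∀ p q, 0 ≤ p → p ≤ q → G p ≤ G q)
    {x y : ℝ} (hxy : x < y) : A * (y - x) ≤ θ * (y - x) + F y - F x := by
  by_contra! hcon
  set d := y - x with hd
  have hd0 : 0 < d := sub_pos.2 hxy
  obtain ⟨p, hp0, hpA, hp⟩ : ∃ p > 0, p < A ∧ θ * d + F y - F x < p * d := by
    obtain ⟨p, h1, h2⟩ := exists_between (max_lt hA ((div_lt_iff₀ hd0).2 hcon))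
    exact ⟨p, (le_max_left _ _).trans_lt h1, h2,
      (div_lt_iff₀ hd0).1 ((le_max_right _ _).trans_lt h1)⟩
  -- Both inequalities are strict at `k = 0`, hence persist for small `k > 0`.
  obtain ⟨k, hk, hkG, hkd⟩ : ∃ k > 0, k * p < lam - β - G p ∧
      (θ * d + F y - F x) * (1 + k * d) < p * d := by
    have t1 : Tendsto (fun k : ℝ => k * p) (𝓝[>] 0) (𝓝 (0 * p)) :=
      ((continuous_id.mul continuous_const).tendsto 0).mono_left nhdsWithin_le_nhds
    have t2 : Tendsto (fun k : ℝ => (θ * d + F y - F x) * (1 + k * d)) (𝓝[>] 0)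
        (𝓝 ((θ * d + F y - F x) * (1 + 0 * d))) :=
      (Continuous.tendsto (by fun_prop) 0).mono_left nhdsWithin_le_nhds
    have e1 := t1.eventually_lt_const (u := lam - β - G p)
      (by rw [zero_mul]; linarith [hG p hp0.le hpA])
    have e2 := t2.eventually_lt_const (u := p * d) (by rwa [zero_mul, add_zero, mul_one])
    obtain ⟨k, ⟨h1, h2⟩, h3⟩ := ((e1.and e2).and self_mem_nhdsWithin).exists
    exact ⟨k, h3, h1, h2⟩
  -- An exponential, since a convex parabola would acquire negative slopes far to the left; here `θ
  -- + φ'` stays in `(0, p]` left of `y`, and `φ + θ z` is positive.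
  let φ : ℝ → ℝ := fun z => p / k * Real.exp (k * (z - y)) - θ * z
  have hφ : ContDiff ℝ 2 φ := by fun_prop
  have hexp : ∀ z, HasDerivAt (fun z => Real.exp (k * (z - y))) (Real.exp (k * (z - y)) * k) z :=
    fun z => by
      have h := (((hasDerivAt_id' z).sub_const y).const_mul k).exp
      rwa [mul_one] at h
  have hφ1 : ∀ z, HasDerivAt φ (p * Real.exp (k * (z - y)) - θ) z := fun z => by
    refine (((hexp z).const_mul (p / k)).sub ((hasDerivAt_id' z).const_mul θ)).congr_deriv ?_
    field_simp
  have hφ1' : deriv φ = fun z => p * Real.exp (k * (z - y)) - θ := funext fun z => (hφ1 z).deriv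
  have hφ2 : ∀ z, deriv (deriv φ) z = p * (Real.exp (k * (z - y)) * k) := fun z => by
    rw [hφ1']
    exact (((hexp z).const_mul p).sub_const θ).deriv
  have hbot : Tendsto (fun z => F z - φ z) atBot atBot := by
    refine tendsto_atBot_mono (fun z => ?_) (tendsto_linear_add_sublinear_atBot hsub hθ)
    have : 0 ≤ p / k * Real.exp (k * (z - y)) := by positivity
    simp only [φ]
    linarith
  obtain ⟨z, hzy, hz⟩ := exists_isLocalMax_lt_of_tendsto_atBot
    (hF.continuous.sub hφ.continuous) hbot hxy (by
      -- Hence the exponential rises by at least `p * d / (1 + k * d)` from `x` to `y`, which is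
      -- what `hkd` was chosen for.
      have he : Real.exp (k * (x - y)) ≤ 1 / (1 + k * d) := by
        have h1 := Real.add_one_le_exp (k * d)
        have : k * (x - y) = -(k * d) := by rw [hd]; ring
        rw [this, Real.exp_neg, ← one_div]
        exact one_div_le_one_div_of_le (by positivity) (by linarith)
      have h2 : p / k * Real.exp (k * (x - y)) ≤ p / k * (1 / (1 + k * d)) := by gcongr
      have h3 : p / k - p / k * (1 / (1 + k * d)) = p * d / (1 + k * d) := by
        field_simp
        ring
      have h4 := (lt_div_iff₀ (by positivity)).2 hkd
      simp only [φ, Pi.sub_apply, sub_self, mul_zero, Real.exp_zero, mul_one]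
      have h5 : θ * d = θ * y - θ * x := by rw [hd]; ring
      linarith)
  have h := hF.subsolution φ hφ z hz
  rw [hφ2, (hφ1 z).deriv] at h
  have he1 : Real.exp (k * (z - y)) ≤ 1 := Real.exp_le_one_iff.2 (by nlinarith)
  have he0 := Real.exp_pos (k * (z - y))
  have hGz : G (θ + (p * Real.exp (k * (z - y)) - θ)) ≤ G p := hmono _ _
    (by rw [add_sub_cancel]; positivity) (by rw [add_sub_cancel]; nlinarith)
  have h2 : a z * (p * (Real.exp (k * (z - y)) * k)) ≤ k * p := by
    have : a z * Real.exp (k * (z - y)) ≤ 1 := mul_le_one₀ (ha z).2 he0.le he1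
    nlinarith [mul_pos hk hp0]
  nlinarith [mul_le_mul_of_nonneg_left (hV z).2 hβ]

/-- Two-sided slope bounds for sublinear Lipschitz correctors with positive mean slope. -/
lemma slope_bounds {a V G F : ℝ → ℝ} {β θ lam A B : ℝ}
    (ha : ∀ x, a x ∈ Icc (0 : ℝ) 1) (hV : ∀ x, V x ∈ Icc (0 : ℝ) 1) (hβ : 0 ≤ β)
    (hlam : β < lam) (hnn : ∀ p, 0 ≤ G p) (h0 : G 0 = 0) (hconv : ConvexOn ℝ univ G)
    (hF : IsStationarySolution a V G β θ lam F) (hlip : ∃ K, LipschitzWith K F)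
    (hsub : IsSublinear F) (hθ : 0 < θ) (hA : 0 < A) (hB : 0 < B)
    (hGA : G A = lam - β) (hGB : G B = lam) {x y : ℝ} (hxy : x < y) :
    A * (y - x) ≤ θ * (y - x) + F y - F x ∧ θ * (y - x) + F y - F x ≤ B * (y - x) := by
  refine ⟨le_slope_of_subsolution ha hV hβ hF hsub hθ hA (fun p hp hpA => ?_)
      (fun p q hp hpq => le_of_convexOn_of_nonneg hconv h0 hnn hp hpq) hxy,
    slope_le_of_supersolution ha hV hβ hF hlip (fun p hp => ?_)
      (fun p q hp hpq => le_of_convexOn_of_nonneg hconv h0 hnn (hB.trans hp).le hpq) hxy⟩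
  · rw [← hGA]
    exact lt_of_convexOn_of_pos hconv h0 hp hpA (by linarith)
  · rw [← hGB]
    exact lt_of_convexOn_of_pos_left hconv h0 hnn hB hp (by linarith)

lemma exists_levels {G : ℝ → ℝ} {β lam γ α : ℝ} (hβ : 0 < β) (hlam : β < lam)
    (hnn : ∀ p, 0 ≤ G p) (h0 : G 0 = 0) (hconv : ConvexOn ℝ univ G) (hc : Continuous G)
    (hγ : 0 < γ) (hα : 0 < α) (hlow : ∀ p, α * |p| ^ γ - 1 / α ≤ G p) :
    ∃ A B : ℝ, 0 < A ∧ A < B ∧ G A = lam - β ∧ G B = lam := by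
  obtain ⟨A, hA, hGA⟩ := exists_pos_eq_of_coercive hc h0 hγ hα hlow (sub_pos.2 hlam)
  obtain ⟨B, hB, hGB⟩ := exists_pos_eq_of_coercive hc h0 hγ hα hlow (hβ.trans hlam)
  refine ⟨A, B, hA, ?_, hGA, hGB⟩
  by_contra! h
  have := le_of_convexOn_of_nonneg hconv h0 hnn hB.le h
  linarith

/-! ### Reflection and passage to the derivative -/

/-- Reflection `x ↦ -x` of a stationary solution. -/
lemma IsStationarySolution.comp_neg {a V G F : ℝ → ℝ} {β θ lam : ℝ}
    (hF : IsStationarySolution a V G β θ lam F) :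
    IsStationarySolution (fun x => a (-x)) (fun x => V (-x)) (fun p => G (-p)) β (-θ) lam
      (fun x => F (-x)) := by
  have hd1 : ∀ (φ : ℝ → ℝ), deriv (fun z => φ (-z)) = fun z => -deriv φ (-z) := fun φ =>
    funext fun z => deriv_comp_neg φ z
  have hd2 : ∀ (φ : ℝ → ℝ) (z : ℝ), deriv (deriv fun z => φ (-z)) z = deriv (deriv φ) (-z) :=
    fun φ z => by
      rw [hd1, deriv.fun_neg, deriv_comp_neg (deriv φ) z, neg_neg]
  have ht : ∀ x : ℝ, Tendsto (fun z : ℝ => -z) (𝓝 (-x)) (𝓝 x) := fun x => by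
    simpa using (continuous_neg.tendsto (-x))
  refine ⟨hF.continuous.comp continuous_neg, fun φ hφ x hx => ?_, fun φ hφ x hx => ?_⟩
  · have hloc : IsLocalMax (fun z => F z - φ (-z)) (-x) := by
      have := (ht x).eventually hx
      simpa [IsLocalMax, IsMaxFilter] using this
    have h := hF.subsolution (fun z => φ (-z)) (hφ.comp contDiff_neg) (-x) hloc
    rw [hd2, hd1] at h
    simp only [neg_neg] at h
    rwa [neg_add, neg_neg]
  · have hloc : IsLocalMin (fun z => F z - φ (-z)) (-x) := by
      have := (ht x).eventually hx
      simpa [IsLocalMin, IsMinFilter] using this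
    have h := hF.supersolution (fun z => φ (-z)) (hφ.comp contDiff_neg) (-x) hloc
    rw [hd2, hd1] at h
    simp only [neg_neg] at h
    rwa [neg_add, neg_neg]

lemma IsSublinear.comp_neg {F : ℝ → ℝ} (hF : IsSublinear F) : IsSublinear fun x => F (-x) := by
  have h := Tendsto.comp hF (Homeomorph.neg ℝ).isClosedEmbedding.tendsto_cocompact
  simpa [IsSublinear, Function.comp_def] using h

/-- Increment bounds of a Lipschitz function pass to its derivative almost everywhere. -/
lemma ae_deriv_bounds {F : ℝ → ℝ} (hlip : ∃ K, LipschitzWith K F) {θ m M : ℝ}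
    (h : ∀ x y, x < y → m * (y - x) ≤ θ * (y - x) + F y - F x ∧
      θ * (y - x) + F y - F x ≤ M * (y - x)) :
    ∀ᵐ y : ℝ, DifferentiableAt ℝ F y ∧ m ≤ θ + deriv F y ∧ θ + deriv F y ≤ M := by
  obtain ⟨K, hK⟩ := hlip
  filter_upwards [hK.ae_differentiableAt (μ := volume)] with y hy
  -- Differentiability is known at `y`, so right difference quotients suffice.
  have ht := (hasDerivAt_iff_tendsto_slope.1 hy.hasDerivAt).mono_left
    (nhdsWithin_mono y fun z (hz : z ∈ Ioi y) => ne_of_gt hz)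
  have hev : ∀ᶠ z in 𝓝[>] y, m - θ ≤ slope F y z ∧ slope F y z ≤ M - θ := by
    filter_upwards [self_mem_nhdsWithin] with z hz
    have hz' : 0 < z - y := sub_pos.2 hz
    obtain ⟨h1, h2⟩ := h y z hz
    rw [slope_def_field, le_div_iff₀ hz', div_le_iff₀ hz']
    constructor <;> linarith
  have h1 := ge_of_tendsto ht (hev.mono fun z hz => hz.1)
  have h2 := le_of_tendsto ht (hev.mono fun z hz => hz.2)
  exact ⟨hy, by linarith, by linarith⟩

end ViscousHJ

theorem mainTheorem6 {Ω : Type*} [TopologicalSpace Ω] [PolishSpace Ω] [MeasurableSpace Ω]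
    [OpensMeasurableSpace Ω] (P : MeasureTheory.Measure Ω) [MeasureTheory.IsProbabilityMeasure P]
    (τ : ℝ → Ω → Ω) (hτ : ViscousHJ.IsErgodicFlow P τ)
    (κ : ℝ) (hκ : 0 < κ) (a V : ℝ → Ω → ℝ) (haV : ViscousHJ.IsMedium P τ κ a V)
    (β : ℝ) (hβ : 0 < β)
    (γ α₀ α₁ : ℝ) (hγ : 1 < γ) (hα₀ : 0 < α₀) (hα₁ : 0 < α₁)
    (G : ℝ → ℝ) (hG : ViscousHJ.IsHamiltonian γ α₀ α₁ G) (hG_nonneg : ∀ p, 0 ≤ G p)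
    (hG_zero : G 0 = 0) (hG_convex : ConvexOn ℝ Set.univ G)
    (θ lam : ℝ) (hlam : lam = ViscousHJ.effectiveHamiltonian P a V G β θ) (hlam_gt : β < lam)
    (F : Ω → C(ℝ, ℝ)) (S : Set Ω) (hF : ViscousHJ.IsCorrector P τ a V G β θ lam F S) :
    (0 < θ →
      (∃ A B : ℝ, 0 < A ∧ A < B ∧ G A = lam - β ∧ G B = lam) ∧
      ∀ A B : ℝ, 0 < A → 0 < B → G A = lam - β → G B = lam → ∀ ω ∈ S,
        (∀ y x : ℝ, x < y →
          θ * (x - y) + F ω x - F ω y ≤ A * (x - y) ∧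
          B * (x - y) ≤ θ * (x - y) + F ω x - F ω y) ∧
        ∀ᵐ y : ℝ, DifferentiableAt ℝ (F ω) y ∧
          A ≤ θ + deriv (F ω) y ∧ θ + deriv (F ω) y ≤ B) ∧
    (θ < 0 →
      (∃ A B : ℝ, 0 < A ∧ A < B ∧ G (-A) = lam - β ∧ G (-B) = lam) ∧
      ∀ A B : ℝ, 0 < A → 0 < B → G (-A) = lam - β → G (-B) = lam → ∀ ω ∈ S,
        (∀ y x : ℝ, y < x →
          θ * (x - y) + F ω x - F ω y ≤ -A * (x - y) ∧
          -B * (x - y) ≤ θ * (x - y) + F ω x - F ω y) ∧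
        ∀ᵐ y : ℝ, DifferentiableAt ℝ (F ω) y ∧
          -B ≤ θ + deriv (F ω) y ∧ θ + deriv (F ω) y ≤ -A) := by
  have ha := fun ω x => haV.process_a.mem_Icc x ω
  have hV := fun ω x => haV.process_V.mem_Icc x ω
  have hγ0 : 0 < γ := zero_lt_one.trans hγ
  refine ⟨fun hθ => ⟨ViscousHJ.exists_levels hβ hlam_gt hG_nonneg hG_zero hG_convex hG.continuous
    hγ0 hα₀ hG.lower, fun A B hA hB hGA hGB ω hω => ?_⟩, fun hθ => ⟨?_, ?_⟩⟩
  · have key : ∀ x y : ℝ, x < y → A * (y - x) ≤ θ * (y - x) + F ω y - F ω x ∧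
        θ * (y - x) + F ω y - F ω x ≤ B * (y - x) := fun x y hxy =>
      ViscousHJ.slope_bounds (ha ω) (hV ω) hβ.le hlam_gt hG_nonneg hG_zero hG_convex
        (hF.solution ω hω) (hF.lipschitz ω hω) (hF.sublinear ω hω) hθ hA hB hGA hGB hxy
    refine ⟨fun y x hxy => ?_, ViscousHJ.ae_deriv_bounds (hF.lipschitz ω hω) key⟩
    obtain ⟨h1, h2⟩ := key x y hxy
    constructor <;> linarith
  · refine ViscousHJ.exists_levels (G := fun p => G (-p)) hβ hlam_gt (fun p => hG_nonneg _)
      (by simpa using hG_zero) ?_ (hG.continuous.comp continuous_neg) hγ0 hα₀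
      (fun p => by simpa using hG.lower (-p))
    simpa [Function.comp_def] using hG_convex.comp_linearMap (-LinearMap.id)
  · intro A B hA hB hGA hGB ω hω
    have hconv : ConvexOn ℝ Set.univ fun p => G (-p) := by
      simpa [Function.comp_def] using hG_convex.comp_linearMap (-LinearMap.id)
    have hlip : ∃ K, LipschitzWith K fun x => F ω (-x) := by
      obtain ⟨K, hK⟩ := hF.lipschitz ω hω
      refine ⟨K, LipschitzWith.of_dist_le_mul fun x y => ?_⟩
      simpa using hK.dist_le_mul (-x) (-y)
    have key : ∀ x y : ℝ, x < y → -B * (y - x) ≤ θ * (y - x) + F ω y - F ω x ∧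
        θ * (y - x) + F ω y - F ω x ≤ -A * (y - x) := fun x y hxy => by
      -- The reflected corrector has mean slope `-θ > 0`; the pair `x < y` becomes `-y < -x`.
      have h := ViscousHJ.slope_bounds (G := fun p => G (-p)) (fun z => ha ω (-z))
        (fun z => hV ω (-z)) hβ.le hlam_gt (fun p => hG_nonneg _) (by simpa using hG_zero) hconv
        (hF.solution ω hω).comp_neg hlip (hF.sublinear ω hω).comp_neg (neg_pos.2 hθ) hA hB
        hGA hGB (neg_lt_neg hxy)
      simp only [neg_neg] at h
      constructor <;> linarith [h.1, h.2]
    refine ⟨fun y x hxy => (key y x hxy).symm, ViscousHJ.ae_deriv_bounds (hF.lipschitz ω hω) key⟩
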